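/- Let $X$ be a real Banach space with $X\neq\{0\}$, and let $X^*$ be its topological dual. Let $\mathscr{C}(X)$ be the set of norm lower semicontinuous proper convex functions $f:X\to\mathbb{R}\cup\{+\infty\}$, and let $\mathscr{C}_{w^*}(X^*)$ be the set of weak$^*$ lower semicontinuous proper convex functions $g:X^*\to\mathbb{R}\cup\{+\infty\}$ (proper means not identically $+\infty$), both with the pointwise order. For $f\in\mathscr{C}(X)$ let $f^*(u)=\sup_{x\in X}\{\langle u,x\rangle-f(x)\}$, $u\in X^*$, be its Fenchel conjugate. An operator $S:\mathscr{C}(X)\to\mathscr{C}_{w^*}(X^*)$ is called fully order reversing if it is onto and, for all $f,g\in\mathscr{C}(X)$, $f\le g$ if and only if $S(f)\ge S(g)$. Theorem. An operator $S:\mathscr{C}(X)\to\mathscr{C}_{w^*}(X^*)$ is fully order reversing if and only if there exist $v\in X^*$, $y\in X$, $\rho\in\mathbb{R}$, $\tau>0$ and a continuous linear automorphism $H$ of $X$ such that $$S(f)(u)=\tau f^*(H^*u+v)+\langle u,y\rangle+\rho$$ for all $f\in\mathscr{C}(X)$ and all $u\in X^*$, where $H^*:X^*\to X^*$ is the adjoint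 of $H$, $H^*u=u\circ H$. -/

import Mathlib

/-- A convex function `E → ℝ ∪ {±∞}` : the convexity inequality, with extended real arithmetic.
It is only used together with `IsProperFun`, so that `∞ - ∞` does not occur in it. -/
def IsConvexFun {E : Type*} [AddCommGroup E] [Module ℝ E] (f : E → EReal) : Prop :=
  ∀ x y : E, ∀ a b : ℝ, 0 < a → 0 < b → a + b = 1 →
    f (a • x + b • y) ≤ (a : EReal) * f x + (b : EReal) * f y

/-- A proper function: it takes values in `ℝ ∪ {+∞}` and is not identically `+∞`. -/
def IsProperFun {E : Type*} (f : E → EReal) : Prop :=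
  (∀ x, f x ≠ ⊥) ∧ ∃ x, f x ≠ ⊤

/-- The set of lower semicontinuous proper convex functions `E → ℝ ∪ {+∞}` on a real vector space
with a topology. As a subtype of `E → EReal` it carries the pointwise order. -/
abbrev LscProperConvex (E : Type*) [AddCommGroup E] [Module ℝ E] [TopologicalSpace E] : Type _ :=
  {f : E → EReal // LowerSemicontinuous f ∧ IsProperFun f ∧ IsConvexFun f}

/-- The weak* lower semicontinuous proper convex functions on the dual of `X`. -/
abbrev WeakStarLscProperConvex (X : Type*) [NormedAddCommGroup X] [NormedSpace ℝ X] : Type _ :=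
  LscProperConvex (WeakDual ℝ X)

/-- The Fenchel conjugate `f*(u) = sup_x (⟨u, x⟩ - f x)`. -/
noncomputable def fenchelConj {X : Type*} [NormedAddCommGroup X] [NormedSpace ℝ X]
    (f : X → EReal) (u : StrongDual ℝ X) : EReal :=
  ⨆ x : X, (((u x : ℝ) : EReal) - f x)

/-- `S` is fully order reversing: `f ≤ g` if and only if `S f ≥ S g`, and `S` is onto. -/
def FullyOrderReversing {A B : Type*} [LE A] [LE B] (S : A → B) : Prop :=
  (∀ f g : A, f ≤ g ↔ S f ≥ S g) ∧ Function.Surjective S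

/-! Order alone recognises two families: the functions whose majorants form a chain are the point
indicators, and those whose minorants form a chain are the continuous affine functions
(`exists_eq_point_of_chain`, `exists_eq_affine_of_chain`). An order reversing surjection therefore
exchanges them.

Since `affine u c ≤ point x r` means `u x - c ≤ r`, the exchange yields one functional equation, `p
x (φ u) - γ u c = q x (u x - c)` (`exists_incidence`). Comparing instances with equal right-hand
sides gives a Cauchy equation, so `γ u` is affine with a slope `τ > 0` common to all `u`. Then `φ`
and `p` are affine with linear parts adjoint up to `τ`, and the closed graph theorem supplies the
automorphism. As `f* u ≤ c` means `affine u c ≤ f`, the values of `S f` are read off from `f*`.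

The converse is biconjugation: Hahn–Banach makes each function the supremum of its affine minorants,
and weak* continuous functionals are evaluations. -/

open Set Filter Topology

set_option linter.unusedSectionVars false

namespace LscProperConvex

/-! ### Epigraphs, affine functions and point indicators -/

section Epigraph

variable {E : Type*} [AddCommGroup E] [Module ℝ E] [TopologicalSpace E]

/-- The epigraph of an extended-real-valued function, as a subset of `E × ℝ`. -/
def realEpigraph (f : E → EReal) : Set (E × ℝ) := {p | f p.1 ≤ (p.2 : EReal)}

theorem isClosed_realEpigraph {E : Type*} [TopologicalSpace E] {f : E → EReal}
    (hf : LowerSemicontinuous f) :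
    IsClosed (realEpigraph f) :=
  (lowerSemicontinuous_iff_isClosed_epigraph.1 hf).preimage
    (f := fun p : E × ℝ => (p.1, (p.2 : EReal)))
    (continuous_fst.prodMk (continuous_coe_real_ereal.comp continuous_snd))

theorem lowerSemicontinuous_of_isClosed_realEpigraph {E : Type*} [TopologicalSpace E]
    {f : E → EReal} (hbot : ∀ x, f x ≠ ⊥) (hf : IsClosed (realEpigraph f)) : LowerSemicontinuous f := by
  rw [lowerSemicontinuous_iff_isClosed_preimage]
  intro r
  induction r with
  | bot =>
    have : f ⁻¹' Iic ⊥ = ∅ := by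
      ext x
      simp [hbot x]
    rw [this]
    exact isClosed_empty
  | top => simp
  | coe r => exact hf.preimage (f := fun x : E => (x, r)) (by fun_prop)

theorem convex_realEpigraph {E : Type*} [AddCommGroup E] [Module ℝ E] {f : E → EReal}
    (hf : IsConvexFun f) :
    Convex ℝ (realEpigraph f) := by
  rw [convex_iff_forall_pos]
  rintro ⟨x, r⟩ hx ⟨y, s⟩ hy a b ha hb hab
  refine (hf x y a b ha hb hab).trans ?_
  have h := add_le_add
    (mul_le_mul_of_nonneg_left (show f x ≤ (r : EReal) from hx)
      (EReal.coe_nonneg.2 ha.le))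
    (mul_le_mul_of_nonneg_left (show f y ≤ (s : EReal) from hy)
      (EReal.coe_nonneg.2 hb.le))
  exact h.trans (le_of_eq (by simp))

theorem isConvexFun_of_convex_realEpigraph {E : Type*} [AddCommGroup E] [Module ℝ E]
    {f : E → EReal} (hbot : ∀ x, f x ≠ ⊥) (hf : Convex ℝ (realEpigraph f)) : IsConvexFun f := by
  intro x y a b ha hb hab
  have hpos : ∀ z : E, ∀ c : ℝ, 0 < c → (c : EReal) * f z ≠ ⊥ := by
    intro z c hc
    induction h : f z with
    | bot => exact absurd h (hbot z)
    | top => simp [EReal.coe_mul_top_of_pos hc]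
    | coe r => rw [← EReal.coe_mul]; exact EReal.coe_ne_bot _
  induction hx : f x with
  | bot => exact absurd hx (hbot x)
  | top =>
    rw [EReal.coe_mul_top_of_pos ha, EReal.top_add_of_ne_bot (hpos y b hb)]
    exact le_top
  | coe r =>
    induction hy : f y with
    | bot => exact absurd hy (hbot y)
    | top =>
      rw [EReal.coe_mul_top_of_pos hb, ← EReal.coe_mul,
        EReal.add_top_of_ne_bot (EReal.coe_ne_bot _)]
      exact le_top
    | coe s =>
      have := hf (x := (x, r)) (y := (y, s)) (show f x ≤ _ from hx.le) (show f y ≤ _ from hy.le)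
        ha.le hb.le hab
      have h2 : f (a • x + b • y) ≤ ((a * r + b * s : ℝ) : EReal) := this
      exact h2.trans (le_of_eq (by simp))

/-- A function that avoids `⊥`, is somewhere finite and has a closed convex real epigraph. -/
def ofRealEpigraph (f : E → EReal) (hbot : ∀ x, f x ≠ ⊥) (htop : ∃ x, f x ≠ ⊤)
    (hclosed : IsClosed (realEpigraph f)) (hconvex : Convex ℝ (realEpigraph f)) :
    LscProperConvex E :=
  ⟨f, lowerSemicontinuous_of_isClosed_realEpigraph hbot hclosed, ⟨hbot, htop⟩,
    isConvexFun_of_convex_realEpigraph hbot hconvex⟩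

/-- The function `x ↦ u x - c`. -/
def affine (u : E →L[ℝ] ℝ) (c : ℝ) : LscProperConvex E :=
  ofRealEpigraph (fun x => ((u x - c : ℝ) : EReal)) (fun _ => EReal.coe_ne_bot _)
    ⟨0, EReal.coe_ne_top _⟩
    (by
      simp only [realEpigraph, EReal.coe_le_coe_iff]
      exact isClosed_le (by fun_prop) (by fun_prop))
    (by
      rintro ⟨x, r⟩ hx ⟨y, s⟩ hy a b ha hb hab
      simp only [realEpigraph, EReal.coe_le_coe_iff, mem_ofPred_eq] at hx hy ⊢
      have h1 := mul_le_mul_of_nonneg_left hx ha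
      have h2 := mul_le_mul_of_nonneg_left hy hb
      have : c = a * c + b * c := by rw [← add_mul, hab, one_mul]
      simp only [Prod.fst_add, Prod.smul_fst, map_add, map_smul, smul_eq_mul, Prod.snd_add,
        Prod.smul_snd]
      linarith)

@[simp] theorem affine_apply (u : E →L[ℝ] ℝ) (c : ℝ) (x : E) :
    (affine u c).1 x = ((u x - c : ℝ) : EReal) := rfl

theorem eval_ne_top_iff {f : LscProperConvex E} {x : E} :
    f.1 x ≠ ⊤ ↔ ∃ r : ℝ, f.1 x = r := by
  refine ⟨fun h => ⟨(f.1 x).toReal, (EReal.coe_toReal h (f.2.2.1.1 x)).symm⟩, ?_⟩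
  rintro ⟨r, hr⟩
  rw [hr]
  exact EReal.coe_ne_top r

theorem exists_eval_eq_coe (f : LscProperConvex E) : ∃ x, ∃ r : ℝ, f.1 x = r := by
  obtain ⟨x, hx⟩ := f.2.2.1.2
  exact ⟨x, eval_ne_top_iff.1 hx⟩

open Classical in
/-- The function with value `r` at `x` and `⊤` elsewhere. -/
noncomputable def point [T1Space E] (x : E) (r : ℝ) : LscProperConvex E :=
  have h : realEpigraph (fun y => if y = x then (r : EReal) else ⊤) = {x} ×ˢ Ici r := by
    ext ⟨y, s⟩
    by_cases hy : y = x <;> simp [realEpigraph, hy]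
  ofRealEpigraph (fun y => if y = x then (r : EReal) else ⊤)
    (fun y => by split_ifs <;> simp)
    ⟨x, by simp⟩
    (by rw [h]; exact isClosed_singleton.prod isClosed_Ici)
    (by rw [h]; exact (convex_singleton x).prod (convex_Ici r))

theorem le_point_iff [T1Space E] {f : LscProperConvex E} {x : E} {r : ℝ} :
    f ≤ point x r ↔ f.1 x ≤ r := by
  refine ⟨fun h => (h x).trans (le_of_eq (if_pos rfl)), fun h y => ?_⟩
  by_cases hy : y = x
  · subst hy
    exact h.trans (le_of_eq (if_pos rfl).symm)
  · exact le_top.trans (le_of_eq (if_neg hy).symm)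

theorem affine_le_point_iff [T1Space E] {u : E →L[ℝ] ℝ} {c : ℝ} {x : E} {r : ℝ} :
    affine u c ≤ point x r ↔ u x - c ≤ r := by
  rw [le_point_iff, affine_apply, EReal.coe_le_coe_iff]

theorem point_le_point_iff [T1Space E] {x y : E} {r s : ℝ} :
    point x r ≤ point y s ↔ x = y ∧ r ≤ s := by
  rw [le_point_iff]
  constructor
  · intro h
    have hxy : y = x := by
      by_contra hne
      have : (⊤ : EReal) ≤ s := (le_of_eq (if_neg hne).symm).trans h
      exact EReal.coe_ne_top s (top_le_iff.1 this)
    subst hxy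
    exact ⟨rfl, EReal.coe_le_coe_iff.1 ((le_of_eq (if_pos rfl).symm).trans h)⟩
  · rintro ⟨rfl, h⟩
    exact (le_of_eq (if_pos rfl)).trans (EReal.coe_le_coe_iff.2 h)

theorem affine_le_affine_iff {u w : E →L[ℝ] ℝ} {c d : ℝ} :
    affine u c ≤ affine w d ↔ u = w ∧ d ≤ c := by
  constructor
  · intro h
    have h' : ∀ x, u x - c ≤ w x - d := fun x => EReal.coe_le_coe_iff.1 (h x)
    have h0 := h' 0
    simp only [map_zero, zero_sub, neg_le_neg_iff] at h0
    refine ⟨?_, h0⟩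
    ext x
    by_contra hne
    have hne' : u x - w x ≠ 0 := sub_ne_zero.2 hne
    have h1 := h' (((c - d + 1) / (u x - w x)) • x)
    simp only [map_smul, smul_eq_mul] at h1
    have h2 : (c - d + 1) / (u x - w x) * (u x - w x) = c - d + 1 := div_mul_cancel₀ _ hne'
    linarith
  · rintro ⟨rfl, h⟩ x
    exact EReal.coe_le_coe_iff.2 (by linarith)

theorem affine_le_iff {f : LscProperConvex E} {u : E →L[ℝ] ℝ} {c : ℝ} :
    affine u c ≤ f ↔ ∀ (y : E) (t : ℝ), f.1 y ≤ t → u y - c ≤ t := by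
  constructor
  · intro h y t hy
    exact EReal.coe_le_coe_iff.1 ((h y).trans hy)
  · intro h y
    exact EReal.le_of_forall_lt_iff_le.1 fun t ht => EReal.coe_le_coe_iff.2 (h y t ht.le)

theorem exists_affine_le_of_pos {f : LscProperConvex E} {x : E} {u : E →L[ℝ] ℝ} {a s r : ℝ}
    (ha : 0 < a) (hr : u x + a * r < s) (h : ∀ (y : E) (t : ℝ), f.1 y ≤ t → s < u y + a * t) :
    ∃ (w : E →L[ℝ] ℝ) (c : ℝ), affine w c ≤ f ∧ r < w x - c := by
  refine ⟨-(a⁻¹ • u), -(a⁻¹ * s), affine_le_iff.2 fun y t hy => ?_, ?_⟩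
  · have h1 := mul_lt_mul_of_pos_left (h y t hy) (inv_pos.2 ha)
    rw [mul_add, inv_mul_cancel_left₀ ha.ne'] at h1
    simp only [neg_apply, smul_apply, smul_eq_mul]
    linarith
  · have h1 := mul_lt_mul_of_pos_left hr (inv_pos.2 ha)
    rw [mul_add, inv_mul_cancel_left₀ ha.ne'] at h1
    simp only [neg_apply, smul_apply, smul_eq_mul]
    linarith

/-- Each finite value of `f` gives a point indicator above `f`, and indicators at distinct points
are incomparable. -/
theorem exists_eq_point_of_chain [T1Space E] {f : LscProperConvex E}
    (hf : ∀ g h : LscProperConvex E, f ≤ g → f ≤ h → g ≤ h ∨ h ≤ g) :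
    ∃ (x : E) (r : ℝ), f = point x r := by
  obtain ⟨x, r, hx⟩ := f.exists_eval_eq_coe
  refine ⟨x, r, le_antisymm (le_point_iff.2 hx.le) fun y => ?_⟩
  by_cases hy : f.1 y = ⊤
  · exact le_top.trans hy.ge
  obtain ⟨s, hs⟩ := eval_ne_top_iff.1 hy
  have hyx : y = x := by
    rcases hf _ _ (le_point_iff.2 hx.le) (le_point_iff.2 hs.le) with h | h
    · exact (point_le_point_iff.1 h).1.symm
    · exact (point_le_point_iff.1 h).1
  subst hyx
  exact (le_of_eq (if_pos rfl)).trans hx.ge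

theorem exists_eq_point_of_le [T1Space E] {f : LscProperConvex E} {x : E} {r : ℝ}
    (h : point x r ≤ f) : ∃ s, f = point x s := by
  obtain ⟨y, s, hy⟩ := f.exists_eval_eq_coe
  obtain ⟨rfl, -⟩ := point_le_point_iff.1 (h.trans (le_point_iff.2 hy.le))
  refine ⟨s, le_antisymm (le_point_iff.2 hy.le) fun z => ?_⟩
  by_cases hz : z = x
  · subst hz
    exact (le_of_eq (if_pos rfl)).trans hy.ge
  · exact le_trans le_top ((le_of_eq (if_neg hz).symm).trans (h z))

theorem le_or_le_of_point_le [T1Space E] {f g h : LscProperConvex E} {x : E} {r : ℝ}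
    (hf : f = point x r) (hg : f ≤ g) (hh : f ≤ h) : g ≤ h ∨ h ≤ g := by
  subst hf
  obtain ⟨d, rfl⟩ := exists_eq_point_of_le hg
  obtain ⟨e, rfl⟩ := exists_eq_point_of_le hh
  simpa [point_le_point_iff] using le_total d e

end Epigraph

/-! ### Hahn–Banach separation and affine minorants -/

section Separation

variable {E : Type*} [AddCommGroup E] [Module ℝ E] [TopologicalSpace E]
  [IsTopologicalAddGroup E] [ContinuousSMul ℝ E] [LocallyConvexSpace ℝ E]

theorem exists_separating_functional (f : LscProperConvex E) {x : E} {r : ℝ}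
    (h : (r : EReal) < f.1 x) :
    ∃ (u : E →L[ℝ] ℝ) (a s : ℝ), 0 ≤ a ∧ u x + a * r < s ∧
      ∀ (y : E) (t : ℝ), f.1 y ≤ t → s < u y + a * t := by
  obtain ⟨L, s, hs, hL⟩ := geometric_hahn_banach_point_closed (x := (x, r))
    (convex_realEpigraph f.2.2.2) (isClosed_realEpigraph f.2.1) (fun hmem => not_le.2 h hmem)
  have hsplit : ∀ y t, L (y, t) = L (y, 0) + L (0, 1) * t := by
    intro y t
    have : ((y, t) : E × ℝ) = (y, 0) + t • (0, 1) := by simp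
    rw [this, map_add, map_smul, smul_eq_mul, mul_comm]
  have hL' : ∀ (y : E) (t : ℝ), f.1 y ≤ t → s < L (y, 0) + L (0, 1) * t := fun y t hy => by
    rw [← hsplit]
    exact hL (y, t) hy
  refine ⟨L.comp (ContinuousLinearMap.inl ℝ E ℝ), L (0, 1), s, ?_, ?_, hL'⟩
  -- With a negative vertical coefficient, moving up inside the epigraph would cross the hyperplane.
  · by_contra! hneg
    obtain ⟨y, t, hy⟩ := f.exists_eval_eq_coe
    have h1 := hL' y (max t ((s - L (y, 0)) / L (0, 1)))
      (hy.le.trans (EReal.coe_le_coe_iff.2 (le_max_left _ _)))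
    have h2 := mul_le_mul_of_nonpos_left (le_max_right t ((s - L (y, 0)) / L (0, 1))) hneg.le
    rw [mul_div_cancel₀ _ hneg.ne] at h2
    linarith
  · have := hs
    rw [hsplit] at this
    exact this

theorem exists_affine_le (f : LscProperConvex E) :
    ∃ (u : E →L[ℝ] ℝ) (c : ℝ), affine u c ≤ f := by
  obtain ⟨x, r, hx⟩ := f.exists_eval_eq_coe
  obtain ⟨u, a, s, ha, h1, h2⟩ := f.exists_separating_functional (x := x) (r := r - 1)
    (by rw [hx]; exact EReal.coe_lt_coe_iff.2 (by linarith))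
  have h3 := h2 x r hx.le
  -- The hyperplane separates two points of one vertical line, so it is not vertical: `a > 0`.
  obtain ⟨w, c, hw, -⟩ := exists_affine_le_of_pos (by linarith) h1 h2
  exact ⟨w, c, hw⟩

/-- A proper convex lower semicontinuous function is the supremum of its affine minorants. -/
theorem exists_affine_le_lt (f : LscProperConvex E) {x : E} {r : ℝ} (h : (r : EReal) < f.1 x) :
    ∃ (u : E →L[ℝ] ℝ) (c : ℝ), affine u c ≤ f ∧ r < u x - c := by
  obtain ⟨u, a, s, ha, h1, h2⟩ := f.exists_separating_functional h
  rcases ha.lt_or_eq with ha | rfl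
  · exact exists_affine_le_of_pos ha h1 h2
  obtain ⟨w, c, hw⟩ := f.exists_affine_le
  simp only [zero_mul, add_zero] at h1 h2
  have hs : 0 < s - u x := sub_pos.2 h1
  -- Vertical hyperplane: `s - u` is negative wherever `f` is finite and positive at `x`. Adding `k`
  -- times it to a minorant keeps a minorant, and this `k` lifts its value at `x` above `r`.
  set k : ℝ := |r - (w x - c)| / (s - u x) + 1 with hk
  have hk0 : 0 ≤ k := by positivity
  refine ⟨w - k • u, c - k * s, affine_le_iff.2 fun y t hy => ?_, ?_⟩
  · have h3 := affine_le_iff.1 hw y t hy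
    have h4 := mul_le_mul_of_nonneg_left (h2 y t hy).le hk0
    simp only [sub_apply, smul_apply, smul_eq_mul]
    linarith
  · have h3 : k * (s - u x) = |r - (w x - c)| + (s - u x) := by
      rw [hk, add_mul, div_mul_cancel₀ _ hs.ne', one_mul]
    have h4 := le_abs_self (r - (w x - c))
    simp only [sub_apply, smul_apply, smul_eq_mul]
    linarith

theorem le_iff_forall_affine_le {f g : LscProperConvex E} :
    f ≤ g ↔ ∀ (u : E →L[ℝ] ℝ) (c : ℝ), affine u c ≤ f → affine u c ≤ g := by
  refine ⟨fun h u c hu => hu.trans h, fun h x => ?_⟩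
  refine EReal.ge_of_forall_gt_iff_ge.1 fun r hr => ?_
  obtain ⟨u, c, hu, hr⟩ := f.exists_affine_le_lt hr
  exact (EReal.coe_le_coe_iff.2 hr.le).trans (h u c hu x)

theorem exists_eq_affine_of_slope_eq {f : LscProperConvex E} {u : E →L[ℝ] ℝ}
    (hslope : ∀ (w : E →L[ℝ] ℝ) (c : ℝ), affine w c ≤ f → w = u) :
    ∃ c : ℝ, f = affine u c := by
  obtain ⟨x₀, r₀, hx₀⟩ := f.exists_eval_eq_coe
  have hle : f ≤ affine u (u x₀ - r₀) := by
    refine le_iff_forall_affine_le.2 fun w c hw => ?_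
    obtain rfl := hslope w c hw
    have := affine_le_iff.1 hw x₀ r₀ hx₀.le
    exact affine_le_affine_iff.2 ⟨rfl, by linarith⟩
  refine ⟨u x₀ - r₀, le_antisymm hle fun x => ?_⟩
  refine EReal.le_of_forall_lt_iff_le.1 fun t ht => EReal.coe_le_coe_iff.2 ?_
  by_contra! hlt
  -- A minorant of slope `u` exceeding this value at `x₀` would exceed `t` at `x`.
  have : (((u x₀ - u x + t : ℝ)) : EReal) < f.1 x₀ := by
    rw [hx₀]
    exact EReal.coe_lt_coe_iff.2 (by linarith)
  obtain ⟨w, c, hw, hr⟩ := f.exists_affine_le_lt this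
  obtain rfl := hslope w c hw
  have := affine_le_iff.1 hw x t ht.le
  linarith

theorem exists_eq_affine_of_chain {f : LscProperConvex E}
    (hf : ∀ g h : LscProperConvex E, g ≤ f → h ≤ f → g ≤ h ∨ h ≤ g) :
    ∃ (u : E →L[ℝ] ℝ) (c : ℝ), f = affine u c := by
  obtain ⟨u, c₀, hu⟩ := f.exists_affine_le
  refine ⟨u, exists_eq_affine_of_slope_eq fun w c hw => ?_⟩
  rcases hf _ _ hw hu with h | h
  · exact (affine_le_affine_iff.1 h).1
  · exact (affine_le_affine_iff.1 h).1.symm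

theorem exists_eq_affine_of_le {f : LscProperConvex E} {u : E →L[ℝ] ℝ} {c : ℝ}
    (h : f ≤ affine u c) : ∃ d, f = affine u d :=
  exists_eq_affine_of_slope_eq fun _ _ hw => (affine_le_affine_iff.1 (hw.trans h)).1

theorem le_or_le_of_le_affine {f g h : LscProperConvex E} {u : E →L[ℝ] ℝ} {c : ℝ}
    (hf : f = affine u c) (hg : g ≤ f) (hh : h ≤ f) : g ≤ h ∨ h ≤ g := by
  subst hf
  obtain ⟨d, rfl⟩ := exists_eq_affine_of_le hg
  obtain ⟨e, rfl⟩ := exists_eq_affine_of_le hh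
  simpa [affine_le_affine_iff] using le_total e d

end Separation

/-! ### Exchange of points and affine functions -/

section OrderReversing

variable {E F : Type*} [AddCommGroup E] [Module ℝ E] [TopologicalSpace E]
  [IsTopologicalAddGroup E] [ContinuousSMul ℝ E] [LocallyConvexSpace ℝ E]
  [AddCommGroup F] [Module ℝ F] [TopologicalSpace F]
  [IsTopologicalAddGroup F] [ContinuousSMul ℝ F] [LocallyConvexSpace ℝ F]
  {S : LscProperConvex E → LscProperConvex F}

theorem _root_.FullyOrderReversing.exists_map_point_eq [T1Space E]
    (hS : FullyOrderReversing S) (x : E) (r : ℝ) :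
    ∃ (u : F →L[ℝ] ℝ) (c : ℝ), S (point x r) = affine u c := by
  refine exists_eq_affine_of_chain fun g h hg hh => ?_
  obtain ⟨g, rfl⟩ := hS.2 g
  obtain ⟨h, rfl⟩ := hS.2 h
  exact (le_or_le_of_point_le rfl ((hS.1 _ _).2 hg) ((hS.1 _ _).2 hh)).symm.imp
    (hS.1 _ _).1 (hS.1 _ _).1

theorem _root_.FullyOrderReversing.exists_map_affine_eq [T1Space F]
    (hS : FullyOrderReversing S) (u : E →L[ℝ] ℝ) (c : ℝ) :
    ∃ (y : F) (r : ℝ), S (affine u c) = point y r := by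
  refine exists_eq_point_of_chain fun g h hg hh => ?_
  obtain ⟨g, rfl⟩ := hS.2 g
  obtain ⟨h, rfl⟩ := hS.2 h
  exact (le_or_le_of_le_affine rfl ((hS.1 _ _).2 hg) ((hS.1 _ _).2 hh)).symm.imp
    (hS.1 _ _).1 (hS.1 _ _).1

theorem _root_.FullyOrderReversing.exists_point_of_affine [T1Space E]
    (hS : FullyOrderReversing S) (u : F →L[ℝ] ℝ) (c : ℝ) :
    ∃ (x : E) (r : ℝ), S (point x r) = affine u c := by
  obtain ⟨f, hf⟩ := hS.2 (affine u c)
  suffices ∃ (x : E) (r : ℝ), f = point x r by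
    obtain ⟨x, r, rfl⟩ := this
    exact ⟨x, r, hf⟩
  refine exists_eq_point_of_chain fun g h hg hh => ?_
  exact (le_or_le_of_le_affine hf ((hS.1 _ _).1 hg) ((hS.1 _ _).1 hh)).symm.imp
    (hS.1 _ _).2 (hS.1 _ _).2

theorem _root_.FullyOrderReversing.exists_affine_of_point [T1Space F]
    (hS : FullyOrderReversing S) (y : F) (r : ℝ) :
    ∃ (u : E →L[ℝ] ℝ) (c : ℝ), S (affine u c) = point y r := by
  obtain ⟨f, hf⟩ := hS.2 (point y r)
  suffices ∃ (u : E →L[ℝ] ℝ) (c : ℝ), f = affine u c by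
    obtain ⟨u, c, rfl⟩ := this
    exact ⟨u, c, hf⟩
  refine exists_eq_affine_of_chain fun g h hg hh => ?_
  exact (le_or_le_of_point_le hf ((hS.1 _ _).1 hg) ((hS.1 _ _).1 hh)).symm.imp
    (hS.1 _ _).2 (hS.1 _ _).2

/-- The images of the point indicators `point x r` have slope independent of `r`. -/
theorem _root_.FullyOrderReversing.exists_slope [T1Space E] (hS : FullyOrderReversing S) :
    ∃ (p : E → F →L[ℝ] ℝ) (q : E → ℝ → ℝ), (∀ x r, S (point x r) = affine (p x) (q x r)) ∧
      Function.Surjective p ∧ (∀ x, StrictMono (q x)) ∧ ∀ x, Function.Surjective (q x) := by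
  choose P q hq using hS.exists_map_point_eq
  have hP : ∀ x r, P x r = P x 0 := by
    have h : ∀ x r s, r ≤ s → P x s = P x r := by
      intro x r s hrs
      have := (hS.1 (point x r) (point x s)).1 (point_le_point_iff.2 ⟨rfl, hrs⟩)
      rw [hq, hq] at this
      exact (affine_le_affine_iff.1 this).1
    intro x r
    rcases le_total r 0 with hr | hr
    · exact (h x r 0 hr).symm
    · exact h x 0 r hr
  have hq' : ∀ x r, S (point x r) = affine (P x 0) (q x r) := fun x r => by rw [hq, hP]
  have hmono : ∀ x, StrictMono (q x) := fun x =>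
    strictMono_of_le_iff_le fun r s => by
      have := hS.1 (point x r) (point x s)
      rw [hq', hq', point_le_point_iff, ge_iff_le, affine_le_affine_iff] at this
      simpa using this
  refine ⟨fun x => P x 0, q, hq', fun u => ?_, hmono, fun x t => ?_⟩
  · obtain ⟨x, r, h⟩ := hS.exists_point_of_affine u 0
    rw [hq'] at h
    exact ⟨x, (affine_le_affine_iff.1 h.le).1⟩
  · obtain ⟨y, r, h⟩ := hS.exists_point_of_affine (P x 0) t
    -- The preimage is comparable with `point x 0`, because their images share a slope; hence it
    -- sits at `x`.
    have hyx : y = x := by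
      have hle : ∀ s, t ≤ q x s ∨ q x s ≤ t := fun s => le_total _ _
      rcases hle 0 with h0 | h0
      · have := (hS.1 (point y r) (point x 0)).2
          (by rw [h, hq']; exact affine_le_affine_iff.2 ⟨rfl, h0⟩)
        exact (point_le_point_iff.1 this).1
      · have := (hS.1 (point x 0) (point y r)).2
          (by rw [h, hq']; exact affine_le_affine_iff.2 ⟨rfl, h0⟩)
        exact (point_le_point_iff.1 this).1.symm
    subst hyx
    rw [hq'] at h
    exact ⟨r, le_antisymm (affine_le_affine_iff.1 h.ge).2 (affine_le_affine_iff.1 h.le).2⟩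

/-- The images of the affine functions `affine u c` sit at a point independent of `c`. -/
theorem _root_.FullyOrderReversing.exists_location [T1Space F] (hS : FullyOrderReversing S) :
    ∃ (φ : (E →L[ℝ] ℝ) → F) (γ : (E →L[ℝ] ℝ) → ℝ → ℝ),
      (∀ u c, S (affine u c) = point (φ u) (γ u c)) ∧ Function.Surjective φ := by
  choose P γ hγ using hS.exists_map_affine_eq
  have hP : ∀ u c, P u c = P u 0 := by
    have h : ∀ u c d, c ≤ d → P u c = P u d := by
      intro u c d hcd
      have := (hS.1 (affine u d) (affine u c)).1 (affine_le_affine_iff.2 ⟨rfl, hcd⟩)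
      rw [hγ, hγ] at this
      exact (point_le_point_iff.1 this).1
    intro u c
    rcases le_total c 0 with hc | hc
    · exact h u c 0 hc
    · exact (h u 0 c hc).symm
  have hγ' : ∀ u c, S (affine u c) = point (P u 0) (γ u c) := fun u c => by rw [hγ, hP]
  refine ⟨fun u => P u 0, γ, hγ', fun y => ?_⟩
  obtain ⟨u, c, h⟩ := hS.exists_affine_of_point y 0
  rw [hγ'] at h
  exact ⟨u, (point_le_point_iff.1 h.le).1⟩

/-- A fully order reversing operator acts on affine functions and on point indicators through maps
that are compatible with the pairings. -/
theorem _root_.FullyOrderReversing.exists_incidence [T1Space E] [T1Space F]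
    (hS : FullyOrderReversing S) :
    ∃ (p : E → F →L[ℝ] ℝ) (q : E → ℝ → ℝ) (φ : (E →L[ℝ] ℝ) → F) (γ : (E →L[ℝ] ℝ) → ℝ → ℝ),
      Function.Surjective p ∧ (∀ x, StrictMono (q x)) ∧ (∀ x, Function.Surjective (q x)) ∧
      Function.Surjective φ ∧ (∀ u c x, p x (φ u) - γ u c = q x (u x - c)) ∧
      ∀ f u c, (S f).1 (φ u) ≤ (γ u c : ℝ) ↔ affine u c ≤ f := by
  obtain ⟨p, q, hpq, hp, hq, hq'⟩ := hS.exists_slope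
  obtain ⟨φ, γ, hφγ, hφ⟩ := hS.exists_location
  refine ⟨p, q, φ, γ, hp, hq, hq', hφ, fun u c x => ?_, fun f u c => ?_⟩
  -- Both sides express `affine u c ≤ point x r`, before and after `S`; as `q x` is an increasing
  -- bijection, the thresholds correspond.
  · have key : ∀ r, u x - c ≤ r ↔ p x (φ u) - γ u c ≤ q x r := by
      intro r
      rw [← affine_le_point_iff, hS.1, hpq, hφγ, ge_iff_le, affine_le_point_iff]
      exact sub_le_comm
    refine le_antisymm ((key _).1 le_rfl) ?_
    obtain ⟨r, hr⟩ := hq' x (p x (φ u) - γ u c)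
    rw [← hr]
    exact (hq x).monotone ((key r).2 hr.ge)
  · rw [← le_point_iff, ← hφγ, hS.1]

end OrderReversing

/-! ### Real upper bounds, suprema of affine families, conjugates -/

theorem ereal_ext {a b : EReal} (h : ∀ r : ℝ, a ≤ r ↔ b ≤ r) : a = b :=
  le_antisymm (EReal.le_of_forall_lt_iff_le.1 fun r hr => (h r).2 hr.le)
    (EReal.le_of_forall_lt_iff_le.1 fun r hr => (h r).1 hr.le)

theorem mul_add_add_le_coe_iff {t : ℝ} (ht : 0 < t) (a : EReal) (b c r : ℝ) :
    (t : EReal) * a + (b : EReal) + (c : EReal) ≤ (r : EReal) ↔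
      a ≤ (((r - b - c) / t : ℝ) : EReal) := by
  induction a with
  | bot => simp [EReal.coe_mul_bot_of_pos ht]
  | top =>
    rw [EReal.coe_mul_top_of_pos ht, EReal.top_add_coe, EReal.top_add_coe]
    simp only [top_le_iff, EReal.coe_ne_top]
  | coe a =>
    rw [← EReal.coe_mul, ← EReal.coe_add, ← EReal.coe_add, EReal.coe_le_coe_iff,
      EReal.coe_le_coe_iff, le_div_iff₀ ht]
    constructor <;> intro h <;> linarith

section SupAffine

variable {E : Type*} [AddCommGroup E] [Module ℝ E] [TopologicalSpace E]

/-- The supremum of a nonempty family of affine functions that is bounded above at some point. -/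
theorem exists_le_coe_iff_forall_affine (I : Set ((E →L[ℝ] ℝ) × ℝ)) (hI : I.Nonempty)
    (hbdd : ∃ (x : E) (M : ℝ), ∀ i ∈ I, i.1 x - i.2 ≤ M) :
    ∃ f : LscProperConvex E, ∀ (x : E) (r : ℝ), f.1 x ≤ r ↔ ∀ i ∈ I, i.1 x - i.2 ≤ r := by
  set f : E → EReal := fun x => ⨆ i ∈ I, ((i.1 x - i.2 : ℝ) : EReal) with hf
  have key : ∀ (x : E) (r : ℝ), f x ≤ r ↔ ∀ i ∈ I, i.1 x - i.2 ≤ r := fun x r => by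
    simp only [hf, iSup_le_iff, EReal.coe_le_coe_iff]
  have hepi : realEpigraph f = ⋂ i ∈ I, realEpigraph (affine i.1 i.2).1 := by
    ext ⟨x, r⟩
    simp [realEpigraph, -EReal.coe_sub, key]
  refine ⟨ofRealEpigraph f (fun x hx => ?_) ?_ ?_ ?_, key⟩
  · obtain ⟨i, hi⟩ := hI
    have := (key x (i.1 x - i.2 - 1)).1 (hx.le.trans bot_le) i hi
    linarith
  · obtain ⟨x, M, h⟩ := hbdd
    exact ⟨x, ne_top_of_le_ne_top (EReal.coe_ne_top M) ((key x M).2 h)⟩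
  · rw [hepi]
    exact isClosed_biInter fun i _ => isClosed_realEpigraph (affine i.1 i.2).2.1
  · rw [hepi]
    exact convex_iInter₂ fun i _ => convex_realEpigraph (affine i.1 i.2).2.2.2

end SupAffine

/-- This expresses the conjugate through the order: the epigraph of `f*` lists the affine minorants
of `f`. -/
theorem fenchelConj_le_coe_iff {X : Type*} [NormedAddCommGroup X] [NormedSpace ℝ X]
    {f : LscProperConvex X} {u : StrongDual ℝ X} {c : ℝ} :
    fenchelConj f.1 u ≤ (c : EReal) ↔ affine u c ≤ f := by
  refine iSup_le_iff.trans (forall_congr' fun x => ?_)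
  rw [affine_apply]
  induction h : f.1 x with
  | bot => exact absurd h (f.2.2.1.1 x)
  | top => simp
  | coe r =>
    rw [← EReal.coe_sub, EReal.coe_le_coe_iff, EReal.coe_le_coe_iff, sub_le_comm]

/-! ### Weak* continuous functionals -/

section WeakDual

variable {X : Type*} [NormedAddCommGroup X] [NormedSpace ℝ X]

instance _root_.WeakDual.instLocallyConvexSpaceReal : LocallyConvexSpace ℝ (WeakDual ℝ X) :=
  inferInstanceAs (LocallyConvexSpace ℝ (WeakBilin (topDualPairing ℝ X)))

/-- Evaluation at a point, as a weak* continuous functional. -/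
noncomputable def _root_.WeakDual.evalCLM (x : X) : WeakDual ℝ X →L[ℝ] ℝ where
  toFun w := w x
  map_add' _ _ := rfl
  map_smul' _ _ := rfl
  cont := WeakDual.eval_continuous x

@[simp] theorem _root_.WeakDual.evalCLM_apply (x : X) (w : WeakDual ℝ X) :
    WeakDual.evalCLM x w = w x := rfl

theorem _root_.WeakDual.exists_eq_evalCLM (L : WeakDual ℝ X →L[ℝ] ℝ) :
    ∃ x : X, L = WeakDual.evalCLM x := by
  obtain ⟨x, hx⟩ := LinearMap.dualEmbedding_surjective (topDualPairing ℝ X) L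
  refine ⟨x, ?_⟩
  rw [← hx]
  rfl

theorem _root_.WeakDual.evalCLM_injective :
    Function.Injective (WeakDual.evalCLM : X → WeakDual ℝ X →L[ℝ] ℝ) := by
  intro x y h
  exact (SeparatingDual.eq_iff_forall_dual_eq (R := ℝ)).2 fun w =>
    DFunLike.congr_fun h (StrongDual.toWeakDual w)

end WeakDual

/-! ### The Cauchy equation, adjoint surjections and the formula -/

/-- Taking `c = 0` identifies `d` with `η - η 0`, which is thus additive. A monotone surjection of
`ℝ` is continuous, so it is linear. -/
theorem exists_pos_eq_mul_add {η d : ℝ → ℝ} (hη : StrictMono η) (hs : Function.Surjective η)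
    (h : ∀ c s, η (c + s) = η c + d s) : ∃ t : ℝ, 0 < t ∧ ∀ c, η c = t * c + η 0 := by
  have hd : ∀ s, d s = η s - η 0 := fun s => by
    have := h 0 s
    rw [zero_add] at this
    linarith
  let A : ℝ →+ ℝ := AddMonoidHom.mk' (fun s => η s - η 0) fun a b => by
    rw [h, hd]
    ring
  have hA : Continuous A := (hη.monotone.continuous_of_surjective hs).sub continuous_const
  have hlin : ∀ c, η c - η 0 = c * (η 1 - η 0) := fun c => by
    have := (A.toRealLinearMap hA).map_smul c 1
    simpa [A] using this
  refine ⟨η 1 - η 0, sub_pos.2 (hη one_pos), fun c => ?_⟩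
  rw [mul_comm, ← hlin]
  ring

/-- A surjection of a Banach space that is adjoint to a surjection of the dual is a continuous
linear automorphism. -/
theorem exists_continuousLinearEquiv_of_adjoint {X : Type*} [NormedAddCommGroup X]
    [NormedSpace ℝ X] [CompleteSpace X] {ψ : StrongDual ℝ X → StrongDual ℝ X} {k : X → X}
    (hψ : Function.Surjective ψ) (hk : Function.Surjective k)
    (h : ∀ u x, ψ u (k x) = u x) : ∃ K : X ≃L[ℝ] X, ∀ x, K x = k x := by
  have hext : ∀ x y : X, (∀ u, ψ u x = ψ u y) → x = y := fun x y hxy =>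
    (SeparatingDual.eq_iff_forall_dual_eq (R := ℝ)).2 fun w => by
      obtain ⟨u, rfl⟩ := hψ w
      exact hxy u
  let T : X →ₗ[ℝ] X :=
    { toFun := k
      map_add' := fun x y => hext _ _ fun u => by simp only [map_add, h]
      map_smul' := fun c x => hext _ _ fun u => by simp only [map_smul, h, RingHom.id_apply] }
  -- Closed graph theorem: the functionals `ψ u` separate points, and each `ψ u ∘ k = u` is
  -- continuous.
  have hT : Continuous T := T.continuous_of_seq_closed_graph fun x a b ha hb =>
    hext _ _ fun u => by
      have h1 : Tendsto (fun n => ψ u (k (x n))) atTop (𝓝 (ψ u b)) :=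
        ((ψ u).continuous.tendsto b).comp hb
      simp only [h] at h1
      have h2 := tendsto_nhds_unique h1 ((u.continuous.tendsto a).comp ha)
      rw [h2]
      exact (h u a).symm
  have hinj : Function.Injective T := fun x y hxy =>
    (SeparatingDual.eq_iff_forall_dual_eq (R := ℝ)).2 fun u => by
      rw [← h u x, ← h u y]
      exact congrArg (ψ u) hxy
  exact ⟨ContinuousLinearEquiv.ofBijective ⟨T, hT⟩ (LinearMap.ker_eq_bot.2 hinj)
    (LinearMap.range_eq_top.2 hk), fun x => rfl⟩

theorem _root_.FullyOrderReversing.exists_formula {X : Type*} [NormedAddCommGroup X]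
    [NormedSpace ℝ X] [CompleteSpace X] [Nontrivial X]
    {S : LscProperConvex X → WeakStarLscProperConvex X} (hS : FullyOrderReversing S) :
    ∃ (v : StrongDual ℝ X) (y : X) (ρ τ : ℝ) (H : X ≃L[ℝ] X), 0 < τ ∧
      ∀ (f : LscProperConvex X) (u : StrongDual ℝ X),
        (S f).1 (StrongDual.toWeakDual u) =
          (τ : EReal) * fenchelConj f.1 (u.comp (H : X →L[ℝ] X) + v)
            + ((u y : ℝ) : EReal) + (ρ : EReal) := by
  obtain ⟨p, q, φ, γ, hp, hq, hq', hφ, hinc, hle⟩ := hS.exists_incidence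
  choose P hP using fun x => WeakDual.exists_eq_evalCLM (p x)
  have hPsurj : Function.Surjective P := fun y => by
    obtain ⟨x, hx⟩ := hp (WeakDual.evalCLM y)
    exact ⟨x, WeakDual.evalCLM_injective (by rw [← hP, hx])⟩
  have hinc' : ∀ u c x, φ u (P x) - γ u c = q x (u x - c) := fun u c x => by
    rw [← hinc, hP, WeakDual.evalCLM_apply]
  set η : ℝ → ℝ := fun c => -q 0 (-c) with hη
  have hγ : ∀ u c, γ u c = φ u (P 0) + η c := fun u c => by
    have := hinc' u c 0
    rw [map_zero, zero_sub] at this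
    simp only [hη]
    linarith
  -- The pairs `(u, c)` and `(0, c - u x)` give the same argument of `q x`, which is eliminated.
  have hshift : ∀ u x c, η (c - u x) = η c - (φ u (P x - P 0) - φ 0 (P x - P 0)) := by
    intro u x c
    have h1 := hinc' u c x
    have h2 := hinc' 0 (c - u x) x
    rw [hγ] at h1 h2
    rw [zero_apply, zero_sub, neg_sub] at h2
    rw [map_sub, map_sub]
    linarith
  -- Nontriviality of `X` makes the shifts `u₀ (-s • x₀) = -s` run over all of `ℝ`.
  obtain ⟨x₀, hx₀⟩ := exists_ne (0 : X)
  obtain ⟨u₀, hu₀⟩ := SeparatingDual.exists_eq_one (R := ℝ) hx₀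
  obtain ⟨τ, hτ, hητ⟩ := exists_pos_eq_mul_add (η := η)
    (d := fun s => -(φ u₀ (P (-s • x₀) - P 0) - φ 0 (P (-s • x₀) - P 0)))
    (fun a b hab => neg_lt_neg (hq 0 (neg_lt_neg hab)))
    (fun t => by
      obtain ⟨s, hs⟩ := hq' 0 (-t)
      exact ⟨-s, by simp [hη, hs]⟩)
    (fun c s => by
      have := hshift u₀ (-s • x₀) c
      rw [map_smul, hu₀] at this
      simpa [sub_eq_add_neg] using this)
  have hpair : ∀ u x, φ u (P x - P 0) - φ 0 (P x - P 0) = τ * u x := fun u x => by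
    have := hshift u x 0
    rw [hητ (0 - u x)] at this
    linarith
  obtain ⟨K, hK⟩ := exists_continuousLinearEquiv_of_adjoint
    (ψ := fun u => (φ u).toStrongDual - (φ 0).toStrongDual) (k := fun x => τ⁻¹ • (P x - P 0))
    (fun w => by
      obtain ⟨u, hu⟩ := hφ (w + (φ 0).toStrongDual).toWeakDual
      exact ⟨u, by simp [hu]⟩)
    (fun x => by
      obtain ⟨z, hz⟩ := hPsurj (τ • x + P 0)
      exact ⟨z, by simp [hz, hτ.ne']⟩)
    (fun u x => by
      rw [map_smul, sub_apply, WeakDual.toStrongDual_apply, WeakDual.toStrongDual_apply, hpair,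
        smul_eq_mul, inv_mul_cancel_left₀ hτ.ne'])
  refine ⟨-((φ 0).toStrongDual.comp (K : X →L[ℝ] X)), P 0, η 0, τ, K, hτ, fun f u => ?_⟩
  obtain ⟨w, hw⟩ := hφ u.toWeakDual
  -- This inverts `φ`: the choice of `v` gives `w = u ∘ K + v` whenever `φ w = u`.
  have hwu : u.comp (K : X →L[ℝ] X) + -((φ 0).toStrongDual.comp (K : X →L[ℝ] X)) = w := by
    ext x
    have := hpair w x
    rw [hw] at this
    change u (K x) + -(φ 0 (K x)) = w x
    rw [hK, map_smul, map_smul, smul_eq_mul, smul_eq_mul, ← sub_eq_add_neg, ← mul_sub]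
    rw [StrongDual.toWeakDual_apply] at this
    rw [this, inv_mul_cancel_left₀ hτ.ne']
  rw [hwu]
  refine ereal_ext fun r => ?_
  rw [mul_add_add_le_coe_iff hτ, fenchelConj_le_coe_iff, ← hle, hγ, hητ, hw,
    StrongDual.toWeakDual_apply]
  have : u (P 0) + (τ * ((r - u (P 0) - η 0) / τ) + η 0) = r := by
    rw [mul_div_cancel₀ _ hτ.ne']
    ring
  rw [this]

/-! ### The converse: order reversal and surjectivity from the formula -/

theorem fullyOrderReversing_of_formula {X : Type*} [NormedAddCommGroup X] [NormedSpace ℝ X]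
    {S : LscProperConvex X → WeakStarLscProperConvex X} {v : StrongDual ℝ X} {y : X} {ρ τ : ℝ}
    {H : X ≃L[ℝ] X} (hτ : 0 < τ)
    (hS : ∀ (f : LscProperConvex X) (u : StrongDual ℝ X),
      (S f).1 (StrongDual.toWeakDual u) =
        (τ : EReal) * fenchelConj f.1 (u.comp (H : X →L[ℝ] X) + v)
          + ((u y : ℝ) : EReal) + (ρ : EReal)) :
    FullyOrderReversing S := by
  have key : ∀ (f : LscProperConvex X) (u : StrongDual ℝ X) (r : ℝ),
      (S f).1 u.toWeakDual ≤ r ↔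
        affine (u.comp (H : X →L[ℝ] X) + v) ((r - u y - ρ) / τ) ≤ f := fun f u r => by
    rw [hS, mul_add_add_le_coe_iff hτ, fenchelConj_le_coe_iff]
  refine ⟨fun f g => ⟨fun hfg u => ?_, fun hfg => ?_⟩, fun g => ?_⟩
  · exact EReal.le_of_forall_lt_iff_le.1 fun r hr =>
      (key g u.toStrongDual r).2 (((key f u.toStrongDual r).1 hr.le).trans hfg)
  · refine le_iff_forall_affine_le.2 fun w c hw => ?_
    set u : StrongDual ℝ X := (w - v).comp (H.symm : X →L[ℝ] X) with hu
    have hwu : u.comp (H : X →L[ℝ] X) + v = w := by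
      ext x
      simp [hu]
    have hc : (τ * c + u y + ρ - u y - ρ) / τ = c := by
      field_simp
      ring
    have h1 := key f u (τ * c + u y + ρ)
    have h2 := key g u (τ * c + u y + ρ)
    rw [hwu, hc] at h1 h2
    exact h2.1 ((hfg _).trans (h1.2 hw))
  -- At this point, the affine function attached to `(u, r)` equals `(u z - r) / τ` plus a term free
  -- of `u` and `r`. An affine minorant of `g` with slope `z` thus bounds the whole family there.
  · have heval : ∀ (u : StrongDual ℝ X) (r : ℝ) (z : X),
        (u.comp (H : X →L[ℝ] X) + v) (H.symm (τ⁻¹ • (z - y))) - (r - u y - ρ) / τ =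
          (u z - r) / τ + (v (H.symm (τ⁻¹ • (z - y))) + ρ / τ) := fun u r z => by
      simp only [add_apply, ContinuousLinearMap.comp_apply, ContinuousLinearEquiv.coe_coe,
        ContinuousLinearEquiv.apply_symm_apply, map_smul, map_sub, smul_eq_mul]
      field_simp
      ring
    have hmin : ∀ (z : X) (d : ℝ), affine (WeakDual.evalCLM z) d ≤ g →
        ∀ (u : StrongDual ℝ X) (r : ℝ), g.1 u.toWeakDual ≤ r →
          (u.comp (H : X →L[ℝ] X) + v) (H.symm (τ⁻¹ • (z - y))) - (r - u y - ρ) / τ ≤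
            d / τ + (v (H.symm (τ⁻¹ • (z - y))) + ρ / τ) := fun z d hz u r hr => by
      have h1 := affine_le_iff.1 hz _ _ hr
      rw [WeakDual.evalCLM_apply, StrongDual.toWeakDual_apply] at h1
      rw [heval]
      gcongr
      linarith
    -- The preimage of `g` is the supremum of the affine functions that the epigraph of `g` forces
    -- below it.
    obtain ⟨f, hf⟩ := exists_le_coe_iff_forall_affine
      {i : (X →L[ℝ] ℝ) × ℝ | ∃ (u : StrongDual ℝ X) (r : ℝ), g.1 u.toWeakDual ≤ r ∧
        i = (u.comp (H : X →L[ℝ] X) + v, (r - u y - ρ) / τ)}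
      (by
        obtain ⟨u, r, hu⟩ := g.exists_eval_eq_coe
        exact ⟨_, u.toStrongDual, r, hu.le, rfl⟩)
      (by
        obtain ⟨L, d, hL⟩ := g.exists_affine_le
        obtain ⟨z, rfl⟩ := WeakDual.exists_eq_evalCLM L
        refine ⟨H.symm (τ⁻¹ • (z - y)), d / τ + (v (H.symm (τ⁻¹ • (z - y))) + ρ / τ), ?_⟩
        rintro _ ⟨u, r, hr, rfl⟩
        exact hmin z d hL u r hr)
    refine ⟨f, Subtype.ext (funext fun w => ereal_ext fun r => ?_)⟩
    refine (key f w.toStrongDual r).trans ⟨fun h => ?_, fun h => ?_⟩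
    -- No further minorants appear: if `r < g w`, a weak* affine minorant of `g` exceeding `r` at
    -- `w` bounds `f` too low at the corresponding point.
    · by_contra! hlt
      obtain ⟨L, d, hL, hd⟩ := g.exists_affine_le_lt hlt
      obtain ⟨z, rfl⟩ := WeakDual.exists_eq_evalCLM L
      have h1 := affine_le_iff.1 h (H.symm (τ⁻¹ • (z - y))) _ ((hf _ _).2 (by
        rintro _ ⟨u, s, hs, rfl⟩
        exact hmin z d hL u s hs))
      rw [heval, add_le_add_iff_right, div_le_div_iff_of_pos_right hτ,
        WeakDual.toStrongDual_apply] at h1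
      rw [WeakDual.evalCLM_apply] at hd
      linarith
    · exact affine_le_iff.2 fun x t ht => (hf x t).1 ht _ ⟨w.toStrongDual, r, h, rfl⟩

end LscProperConvex

theorem theorem2 {X : Type*} [NormedAddCommGroup X] [NormedSpace ℝ X] [CompleteSpace X]
    [Nontrivial X] (S : LscProperConvex X → WeakStarLscProperConvex X) :
    FullyOrderReversing S ↔
      ∃ (v : StrongDual ℝ X) (y : X) (ρ τ : ℝ) (H : X ≃L[ℝ] X), 0 < τ ∧
        ∀ (f : LscProperConvex X) (u : StrongDual ℝ X),
          (S f).1 (StrongDual.toWeakDual u) =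
            (τ : EReal) * fenchelConj f.1 (u.comp (H : X →L[ℝ] X) + v)
              + ((u y : ℝ) : EReal) + (ρ : EReal) := by
  refine ⟨fun hS => hS.exists_formula, ?_⟩
  rintro ⟨v, y, ρ, τ, H, hτ, hS⟩
  exact LscProperConvex.fullyOrderReversing_of_formula hτ hS
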